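/- **Definition of the bound.** Let $\mathbb N_1=\{1,2,3,\dots\}$ and let $\mathcal F$ be the set of all non-decreasing functions $\mathbb N_1\to\mathbb N_1$. For $f\in\mathcal F$ and $s\in\mathbb N$ let ${}^{s}f\in\mathcal F$ be the function ${}^{s}f(n)=f(s+n)$. Define $\mathcal B(m,f)\in\mathbb N$, for $m\ge 1$ and $f\in\mathcal F$, recursively on $m$: * $\mathcal B(1,f)=f(1)+1$. * For $m\ge 2$ put $\mathcal B(m,f)=\mathcal B_m^0(f)$, where the functions $\mathcal B_m^k:\mathcal F\times\mathbb N^k\to\mathbb N$ are defined by backward recursion on $k=m,m-1,\dots,0$ as follows. First, $\mathcal B_m^m(f,b_1,\dots,b_m)=(b_1+1)\cdots(b_m+1)$. For $0\le k\le m-1$ and $\beta\in\mathbb N^k$ define $g\in\mathcal F$ by $g(1)=1$ and $$g(n+1)=1+g(n)+\mathcal B_m^{k+1}\bigl({}^{g(n)}f,\ \beta,\ f(g(n))\bigr)\qquad(n\ge 1),$$ and put $\mathcal B_m^k(f,\beta)=g\bigl(\mathcal B(m-1,f\circ g)+1\bigr)$. For $m\ge 1$, $d\ge 1$ and $i\in\mathbb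 N$ set $$\gamma_{m,d}(i)=\bigl(3^{\mathcal B(m,\,3^n d)-1}-1\bigr)d+i,$$ where $3^n d$ stands for the function $n\mapsto 3^n d$ in $\mathcal F$. **Corollary 4.5.** Let $K$ be a field, $m\ge 1$, $d\ge 1$ and $s \geq 0$ integers, and let $g,f_1,\dots,f_s\in K[x_1,\dots,x_m]$ with $\deg(f_i)\le d$ for $i=1,\dots,s$. Here $\deg$ is the total degree, with $\deg(0)=0$. Then $g\in\langle f_1,\dots,f_s\rangle$ if and only if there exist $h_1,\dots,h_s\in K[x_1,\dots,x_m]$ such that $g=h_1f_1+\dots+h_sf_s$ and $\deg(h_i)\le\gamma_{m,d}(\deg(g))$ for $i=1,\dots,s$. -/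

import Mathlib

namespace AntichainBound

/-- The sequence `g(1) = 1`, `g(n+1) = 1 + g(n) + C(ˢf, f(s))` with `s = g(n)`, where
`ˢf(i) = f(s + i)`. Sequences are indexed by the integers `n ≥ 1`; the value `g(0) = 0` is a
filler and is not used anywhere below. -/
def jumps (C : (ℕ → ℕ) → ℕ → ℕ) (f : ℕ → ℕ) : ℕ → ℕ
  | 0 => 0
  | 1 => 1
  | n + 2 => 1 + jumps C f (n + 1) +
      C (fun i => f (jumps C f (n + 1) + i)) (f (jumps C f (n + 1)))

/-- For a given `A = B_{m-1}`, the number `partialBound A j f β` with `β ∈ ℕᵏ` and `j = m - k` is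
`B_m^k(f, β)`, defined by backward recursion on `k`, i.e. by recursion on `j`:
* `B_m^m(f, β) = (β₁ + 1) ⋯ (β_m + 1)`;
* `B_m^k(f, β) = g(B_{m-1}(f ∘ g) + 1)` for `k < m`, where `g(1) = 1` and
  `g(n+1) = 1 + g(n) + B_m^{k+1}(ˢf, (β, f(s)))` with `s = g(n)`. -/
def partialBound (A : (ℕ → ℕ) → ℕ) :
    (j : ℕ) → {k : ℕ} → (ℕ → ℕ) → (Fin k → ℕ) → ℕ
  | 0, _, _, β => ∏ i, (β i + 1)
  | j + 1, k, f, β =>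
      let g := jumps
        (fun f' b => partialBound A j f' (Fin.snoc (α := fun _ : Fin (k + 1) => ℕ) β b)) f
      g (A (f ∘ g) + 1)

/-- The number `B(m, f)`, for `m ≥ 1` and a non-decreasing function `f` from the positive integers
to the positive integers: `B(1, f) = f(1) + 1` and `B(m, f) = B_m^0(f)` for `m ≥ 2`.
Only the values `f(n)` with `n ≥ 1` enter; `B(0, f) = 0` is a filler. -/
def bound : ℕ → (ℕ → ℕ) → ℕ
  | 0, _ => 0
  | 1, f => f 1 + 1
  | m + 2, f => partialBound (bound (m + 1)) (m + 2) f (Fin.elim0 : Fin 0 → ℕ)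

/-- `γ_{m,d}(i) = (3 ^ (B(m, 3ⁿd) - 1) - 1) d + i`, where `3ⁿd` stands for the function
`n ↦ 3ⁿd`. Both subtractions are exact for `m ≥ 1`, since then `B(m, f) ≥ 1`. -/
def gammaBound (m d i : ℕ) : ℕ :=
  (3 ^ (bound m (fun n => 3 ^ n * d) - 1) - 1) * d + i

end AntichainBound

/-! Let `V_C` be the space of combinations `∑ hᵢ fᵢ` with `deg hᵢ ≤ C`; its elements have degree at
most `C + d`. Take `C = (3ⁿ - 1) d`, so `C + d = 3ⁿ d`. S-polynomials of elements of `V_C`, and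
their remainders modulo `V_C`, lie in `V_{C + 2·3ⁿd}`, which is the next space in the chain. If that
space has no leading monomial outside those generated by `V_C`, all remainders vanish and `V_C` is a
Gröbner basis (`sPolynomialsReduce_boundedCombinations`). As `degLex` is graded, a standard
representation of `g` costs only `deg g` more.

While new leading monomials keep appearing, their exponents form a sequence bounded by `3ⁿ d` in
which no term divides a later one. Such a sequence has length at most `B(m, 3ⁿd)`
(`IsBadSeq.le_bound`), so the chain stabilises at some `n ≤ B - 1`. -/

namespace AntichainBound

/-! ### Length of bad sequences in `ℕᵐ` -/

/-- The first `N` terms `a 1, …, a N` are bounded coordinatewise by `f`, and no term is below a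
later one. -/
structure IsBadSeq {m : ℕ} (f : ℕ → ℕ) (N : ℕ) (a : ℕ → Fin m → ℕ) : Prop where
  le : ∀ i, 1 ≤ i → i ≤ N → ∀ x, a i x ≤ f i
  not_le : ∀ i j, 1 ≤ i → i < j → j ≤ N → ¬ a i ≤ a j

lemma jumps_succ (C : (ℕ → ℕ) → ℕ → ℕ) (f : ℕ → ℕ) {n : ℕ} (hn : 1 ≤ n) :
    jumps C f (n + 1) =
      1 + jumps C f n + C (fun i => f (jumps C f n + i)) (f (jumps C f n)) := by
  obtain ⟨n, rfl⟩ := Nat.exists_eq_add_of_le' hn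
  rfl

lemma jumps_one (C : (ℕ → ℕ) → ℕ → ℕ) (f : ℕ → ℕ) : jumps C f 1 = 1 := rfl

lemma jumps_strictMono (C : (ℕ → ℕ) → ℕ → ℕ) (f : ℕ → ℕ) : StrictMono (jumps C f) := by
  refine strictMono_nat_of_lt_succ fun n => ?_
  rcases Nat.eq_zero_or_pos n with rfl | hn
  · exact Nat.zero_lt_one
  · rw [jumps_succ C f hn]; omega

lemma IsBadSeq.shift {m : ℕ} {f : ℕ → ℕ} {N : ℕ} {a : ℕ → Fin m → ℕ} (h : IsBadSeq f N a)
    {s N' : ℕ} (hN : s + N' ≤ N) :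
    IsBadSeq (fun i => f (s + i)) N' (fun i => a (s + i)) where
  le i h1 h2 x := h.le (s + i) (by omega) (by omega) x
  not_le i j h1 h2 h3 := h.not_le (s + i) (s + j) (by omega) (by omega) (by omega)

lemma IsBadSeq.le_prod {m : ℕ} {f : ℕ → ℕ} {N : ℕ} {a : ℕ → Fin m → ℕ} (h : IsBadSeq f N a)
    {β : Fin m → ℕ} (hβ : ∀ i, 1 ≤ i → i ≤ N → ∀ x, a i x ≤ β x) :
    N ≤ ∏ x, (β x + 1) := by
  have hinj : Set.InjOn a (Finset.Icc 1 N) := by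
    intro i hi j hj hij
    simp only [Finset.coe_Icc, Set.mem_Icc] at hi hj
    rcases lt_trichotomy i j with hlt | heq | hlt
    · exact absurd hij.le (h.not_le i j hi.1 hlt hj.2)
    · exact heq
    · exact absurd hij.ge (h.not_le j i hj.1 hlt hi.2)
  have hmaps : ∀ i ∈ Finset.Icc 1 N, a i ∈ Fintype.piFinset fun x => Finset.range (β x + 1) := by
    intro i hi
    rw [Finset.mem_Icc] at hi
    simpa [Fintype.mem_piFinset, Nat.lt_succ_iff] using hβ i hi.1 hi.2
  simpa using Finset.card_le_card_of_injOn a hmaps hinj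

/-- If the `p`-th coordinate exceeds `f (g n)` somewhere between `g n` and `g (n + 1)` for each `n`,
the corresponding subsequence stays bad after deleting this coordinate. -/
lemma IsBadSeq.exists_removeNth {m : ℕ} {f g : ℕ → ℕ} {N M : ℕ} {a : ℕ → Fin (m + 1) → ℕ}
    (h : IsBadSeq f N a) (hf : Monotone f) (hg : StrictMono g) (hg1 : g 1 = 1)
    (hN : g (M + 1) ≤ N) (p : Fin (m + 1))
    (hp : ∀ n, 1 ≤ n → n ≤ M → ∃ t, g n < t ∧ t ≤ g (n + 1) ∧ f (g n) < a t p) :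
    ∃ b : ℕ → Fin m → ℕ, IsBadSeq (f ∘ g) (M + 1) b := by
  -- The `n`-th chosen index lies in the block `(g (n-1), g n]`, starting from index 1; as `f ∘ g`
  -- is monotone, its `p`-th coordinate exceeds the bounds of all earlier blocks.
  have key : ∀ n, ∃ t, 1 ≤ n → n ≤ M + 1 →
      1 ≤ t ∧ t ≤ g n ∧ ∀ n', 1 ≤ n' → n' < n → g n' < t ∧ f (g n') < a t p := by
    intro n
    rcases Nat.lt_or_ge n 2 with hn | hn
    · refine ⟨1, fun h1 _ => ?_⟩
      obtain rfl : n = 1 := by omega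
      exact ⟨le_rfl, hg1.ge, fun n' _ _ => by omega⟩
    · obtain ⟨n, rfl⟩ := Nat.exists_eq_add_of_le' (Nat.one_le_of_lt hn)
      by_cases hM : n ≤ M
      · obtain ⟨t, h1, h2, h3⟩ := hp n (by omega) hM
        refine ⟨t, fun _ _ => ⟨by omega, h2, fun n' _ hlt => ?_⟩⟩
        have hle : g n' ≤ g n := hg.monotone (by omega)
        exact ⟨hle.trans_lt h1, (hf hle).trans_lt h3⟩
      · exact ⟨0, fun _ _ => by omega⟩
  choose u hu using key
  have huN : ∀ n, 1 ≤ n → n ≤ M + 1 → u n ≤ N := fun n h1 h2 =>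
    ((hu n h1 h2).2.1.trans (hg.monotone h2)).trans hN
  refine ⟨fun n x => a (u n) (p.succAbove x), ⟨fun i h1 h2 x => ?_, fun i j h1 h2 h3 hle => ?_⟩⟩
  · exact (h.le _ (hu i h1 h2).1 (huN i h1 h2) _).trans (hf (hu i h1 h2).2.1)
  · have hi := hu i h1 (by omega)
    have hj := hu j (by omega) h3
    have hij := hj.2.2 i h1 h2
    refine h.not_le (u i) (u j) hi.1 (hi.2.1.trans_lt hij.1) (huN j (by omega) h3) ?_
    intro x
    rcases Fin.eq_self_or_eq_succAbove p x with rfl | ⟨y, rfl⟩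
    -- The deleted coordinate increases along the chosen terms, so it cannot obstruct a comparison.
    · exact (h.le _ hi.1 (huN i h1 (by omega)) _).trans ((hf hi.2.1).trans hij.2.le)
    · exact hle y

/-- Cut the sequence at the indices `g n`. If coordinate `k` stays at most `f (g n)` throughout a
block, that block is a bad sequence with `k + 1` bounded coordinates, too long for the recursive
bound. Otherwise every block contains a large `k`-th coordinate, and deleting it gives a bad
sequence of length `A (f ∘ g) + 1` in one dimension less. -/
lemma IsBadSeq.le_partialBound {m : ℕ} {A : (ℕ → ℕ) → ℕ}
    (hA : ∀ (f : ℕ → ℕ) (N : ℕ) (a : ℕ → Fin m → ℕ), Monotone f → IsBadSeq f N a → N ≤ A f)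
    (j : ℕ) {k : ℕ} (hk : k + j = m + 1) (f : ℕ → ℕ) (hf : Monotone f) (β : Fin k → ℕ) (N : ℕ)
    (a : ℕ → Fin (m + 1) → ℕ) (h : IsBadSeq f N a)
    (hβ : ∀ i, 1 ≤ i → i ≤ N → ∀ x (hx : x.val < k), a i x ≤ β ⟨x, hx⟩) :
    N ≤ partialBound A j f β := by
  induction j generalizing k f N a with
  | zero =>
    obtain rfl : k = m + 1 := by omega
    exact h.le_prod fun i h1 h2 x => hβ i h1 h2 x x.isLt
  | succ j ih =>
    rw [partialBound]
    set C : (ℕ → ℕ) → ℕ → ℕ := fun f' b =>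
      partialBound A j f' (Fin.snoc (α := fun _ : Fin (k + 1) => ℕ) β b) with hC
    set g := jumps C f with hg
    have hgm : StrictMono g := jumps_strictMono C f
    by_contra! hlt
    obtain ⟨b, hb⟩ := h.exists_removeNth hf hgm (jumps_one C f) hlt.le ⟨k, by omega⟩ (by
      intro n h1 hn
      by_contra! hcon
      have hsucc : g (n + 1) = 1 + g n + C (fun i => f (g n + i)) (f (g n)) := jumps_succ C f h1
      have hle : g (n + 1) ≤ N := (hgm.monotone (by omega)).trans hlt.le
      -- The summand 1 in the recursion for `g` makes the block one term longer than allowed.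
      have := ih (k := k + 1) (by omega) (fun i => f (g n + i)) (fun x y hxy => hf (by omega))
        (Fin.snoc (α := fun _ : Fin (k + 1) => ℕ) β (f (g n)))
        (C (fun i => f (g n + i)) (f (g n)) + 1) _
        (h.shift (s := g n) (by omega)) (by
          intro i hi1 hi2 x hx
          rcases Nat.lt_succ_iff_lt_or_eq.mp hx with hxk | hxk
          · have := hβ (g n + i) (by omega) (by omega) x hxk
            simpa [Fin.snoc, hxk] using this
          · subst hxk
            have := hcon (g n + i) (by omega) (by omega)
            simpa [Fin.snoc] using this)
      simp only [hC] at this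
      omega)
    have := hA (f ∘ g) _ b (hf.comp hgm.monotone) hb
    change g (A (f ∘ g) + 1) < N at hlt
    omega

lemma IsBadSeq.le_bound_one {f : ℕ → ℕ} {N : ℕ} {a : ℕ → Fin 1 → ℕ} (h : IsBadSeq f N a) :
    N ≤ f 1 + 1 := by
  rcases Nat.eq_zero_or_pos N with rfl | hN
  · omega
  have key : ∀ n, 1 ≤ n → n ≤ N → a n 0 + n ≤ f 1 + 1 := by
    intro n hn
    induction n, hn using Nat.le_induction with
    | base => intro h1; exact Nat.add_le_add_right (h.le 1 le_rfl h1 0) 1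
    | succ n hn ih =>
      intro h1
      have h2 := ih (by omega)
      have h3 : ¬ a n 0 ≤ a (n + 1) 0 := fun hle =>
        h.not_le n (n + 1) hn (by omega) h1 fun x => by rwa [Subsingleton.elim x 0]
      omega
  have := key N hN le_rfl
  omega

/-- A bad sequence in `ℕᵐ`, `m ≥ 1`, bounded by a monotone `f` has length at most `B(m, f)`. -/
theorem IsBadSeq.le_bound {m : ℕ} (f : ℕ → ℕ) (N : ℕ) (a : ℕ → Fin (m + 1) → ℕ)
    (hf : Monotone f) (h : IsBadSeq f N a) : N ≤ bound (m + 1) f := by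
  induction m generalizing f N with
  | zero => exact h.le_bound_one
  | succ m ih =>
    exact IsBadSeq.le_partialBound (fun f N a hf h => ih f N a hf h) (m + 2) (Nat.zero_add _) f hf _
      N a h fun i _ _ x hx => absurd hx (Nat.not_lt_zero _)

end AntichainBound

/-! ### Buchberger's criterion -/

namespace MonomialOrder

open MvPolynomial
open scoped MonomialOrder

variable {σ K : Type*} [Field K] (m : MonomialOrder σ)

/-- The `K`-span of the products `xᵃ w`, with `w ∈ W` nonzero, whose degree lies in `D`. -/
noncomputable def shiftSpan (W : Set (MvPolynomial σ K)) (D : Set m.syn) : Submodule K (MvPolynomial σ K) :=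
  Submodule.span K
    {p | ∃ a, ∃ w ∈ W, w ≠ 0 ∧ m.toSyn (a + m.degree w) ∈ D ∧ p = monomial a 1 * w}

variable {m} {W : Set (MvPolynomial σ K)} {D : Set m.syn}

lemma monomial_mul_mem_shiftSpan {w : MvPolynomial σ K} (hw : w ∈ W) (hw0 : w ≠ 0) {a : σ →₀ ℕ}
    (ha : m.toSyn (a + m.degree w) ∈ D) (c : K) : monomial a c * w ∈ m.shiftSpan W D := by
  have : monomial a c * w = c • (monomial a 1 * w) := by
    rw [← smul_mul_assoc, smul_monomial, smul_eq_mul, mul_one]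
  rw [this]
  exact Submodule.smul_mem _ _ (Submodule.subset_span ⟨a, w, hw, hw0, ha, rfl⟩)

lemma shiftSpan_mono {D' : Set m.syn} (h : D ⊆ D') : m.shiftSpan W D ≤ m.shiftSpan W D' :=
  Submodule.span_mono fun _ ⟨a, w, hw, hw0, ha, hp⟩ => ⟨a, w, hw, hw0, h ha, hp⟩

lemma mem_of_mem_support_of_mem_shiftSpan (hD : IsLowerSet D) {p : MvPolynomial σ K}
    (hp : p ∈ m.shiftSpan W D) {e : σ →₀ ℕ} (he : e ∈ p.support) : m.toSyn e ∈ D := by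
  classical
  induction hp using Submodule.span_induction with
  | mem p hp =>
    obtain ⟨a, w, -, -, ha, rfl⟩ := hp
    refine hD ?_ ha
    refine (m.le_degree he).trans (m.degree_mul_le.trans ?_)
    rw [map_add, map_add]
    exact add_le_add_left (m.degree_monomial_le 1) _
  | zero => simp at he
  | add p q _ _ hp hq =>
    rcases Finset.mem_union.mp (support_add he) with h | h
    exacts [hp h, hq h]
  | smul c p _ hp => exact hp (support_smul he)

lemma exists_mem_shiftSpan_Iic {p : MvPolynomial σ K} (hp : p ∈ m.shiftSpan W D) :
    p = 0 ∨ ∃ δ ∈ D, p ∈ m.shiftSpan W (Set.Iic δ) := by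
  induction hp using Submodule.span_induction with
  | mem p hp =>
    obtain ⟨a, w, hw, hw0, ha, rfl⟩ := hp
    exact .inr ⟨_, ha, monomial_mul_mem_shiftSpan hw hw0 (Set.mem_Iic.mpr le_rfl) 1⟩
  | zero => exact .inl rfl
  | add p q _ _ hp hq =>
    rcases hp with rfl | ⟨δ, hδ, hp⟩
    · simpa using hq
    rcases hq with rfl | ⟨ε, hε, hq⟩
    · exact .inr ⟨δ, hδ, by simpa using hp⟩
    rcases le_total δ ε with h | h
    · exact .inr ⟨ε, hε, add_mem (shiftSpan_mono (Set.Iic_subset_Iic.mpr h) hp) hq⟩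
    · exact .inr ⟨δ, hδ, add_mem hp (shiftSpan_mono (Set.Iic_subset_Iic.mpr h) hq)⟩
  | smul c p _ hp =>
    rcases hp with rfl | ⟨δ, hδ, hp⟩
    · exact .inl (smul_zero c)
    · exact .inr ⟨δ, hδ, Submodule.smul_mem _ c hp⟩

lemma mul_mem_shiftSpan {w : MvPolynomial σ K} (hw : w ∈ W) (hw0 : w ≠ 0) {q : MvPolynomial σ K}
    {δ : m.syn} (h : m.toSyn (m.degree (q * w)) ≤ δ) : q * w ∈ m.shiftSpan W (Set.Iic δ) := by
  rcases eq_or_ne q 0 with rfl | hq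
  · simp
  rw [m.degree_mul hq hw0, map_add] at h
  nth_rewrite 1 [q.as_sum]
  rw [Finset.sum_mul]
  refine sum_mem fun e he => monomial_mul_mem_shiftSpan hw hw0 ?_ _
  rw [Set.mem_Iic, map_add]
  exact (add_le_add_left (m.le_degree he) _).trans h

lemma monomial_mul_mem_shiftSpan_of_mem {p : MvPolynomial σ K} {δ : m.syn}
    (hp : p ∈ m.shiftSpan W (Set.Iic δ)) (a : σ →₀ ℕ) (c : K) :
    monomial a c * p ∈ m.shiftSpan W (Set.Iic (m.toSyn a + δ)) := by
  induction hp using Submodule.span_induction with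
  | mem p hp =>
    obtain ⟨b, w, hw, hw0, hb, rfl⟩ := hp
    rw [← mul_assoc, monomial_mul]
    refine monomial_mul_mem_shiftSpan hw hw0 ?_ _
    rw [Set.mem_Iic, add_assoc, map_add]
    exact add_le_add_right hb _
  | zero => simp
  | add p q _ _ hp hq => rw [mul_add]; exact add_mem hp hq
  | smul c' p _ hp => rw [mul_smul_comm]; exact Submodule.smul_mem _ _ hp

/-- Every S-polynomial of two elements of `W` has a standard representation by `W`. -/
def SPolynomialsReduce (m : MonomialOrder σ) (W : Set (MvPolynomial σ K)) : Prop :=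
  ∀ w ∈ W, ∀ w' ∈ W, m.sPolynomial w w' ≠ 0 →
    m.sPolynomial w w' ∈ m.shiftSpan W (Set.Iic (m.toSyn (m.degree (m.sPolynomial w w'))))

lemma SPolynomialsReduce.sPolynomial_mem (hW : m.SPolynomialsReduce W) {w w' : MvPolynomial σ K}
    (hw : w ∈ W) (hw' : w' ∈ W) {a a' e : σ →₀ ℕ}
    (ha : a + m.degree w = e) (ha' : a' + m.degree w' = e) :
    m.sPolynomial (monomial a 1 * w) (monomial a' 1 * w') ∈
      m.shiftSpan W (Set.Iio (m.toSyn e)) := by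
  rw [sPolynomial_monomial_mul, ha, ha', sup_idem]
  rcases eq_or_ne (m.sPolynomial w w') 0 with h0 | h0
  · simp [h0]
  refine shiftSpan_mono (Set.Iic_subset_Iio.mpr ?_)
    (monomial_mul_mem_shiftSpan_of_mem (hW w hw w' hw' h0) _ _)
  have hle : m.degree w ⊔ m.degree w' ≤ e :=
    sup_le (ha ▸ self_le_add_left _ _) (ha' ▸ self_le_add_left _ _)
  calc _ < m.toSyn (e - m.degree w ⊔ m.degree w') + m.toSyn (m.degree w ⊔ m.degree w') :=
        add_lt_add_right (m.degree_sPolynomial_lt_sup_degree h0) _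
    _ = m.toSyn e := by rw [← map_add, tsub_add_cancel_of_le hle]

/-- Modulo lower terms, all generators of degree exactly `δ` are proportional to a single one, since
they differ by S-polynomials. The top coefficient of `p` is zero, so that generator drops out. -/
lemma SPolynomialsReduce.mem_shiftSpan_Iio (hW : m.SPolynomialsReduce W) {p : MvPolynomial σ K}
    {δ : m.syn} (hp : p ∈ m.shiftSpan W (Set.Iic δ)) (hδ : m.toSyn (m.degree p) < δ) :
    p ∈ m.shiftSpan W (Set.Iio δ) := by
  classical
  obtain ⟨e, rfl⟩ := m.toSyn.surjective δ
  by_cases hex : ∃ a, ∃ w ∈ W, w ≠ 0 ∧ a + m.degree w = e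
  · obtain ⟨a, w, hw, hw0, ha⟩ := hex
    set v := monomial a (1 : K) * w with hv
    have hmon : monomial a (1 : K) ≠ 0 := by simp
    have hv0 : v ≠ 0 := mul_ne_zero hmon hw0
    have hvdeg : m.degree v = e := by
      rw [hv, m.degree_mul hmon hw0, m.degree_monomial, if_neg one_ne_zero, ha]
    have hle : m.shiftSpan W (Set.Iic (m.toSyn e)) ≤
        K ∙ v ⊔ m.shiftSpan W (Set.Iio (m.toSyn e)) := by
      refine Submodule.span_le.mpr ?_
      rintro _ ⟨b, u, hu, hu0, hb, rfl⟩
      rcases (Set.mem_Iic.mp hb).lt_or_eq with hlt | heq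
      · exact Submodule.mem_sup_right (monomial_mul_mem_shiftSpan hu hu0 hlt 1)
      · have hb' := m.toSyn.injective heq
        have hudeg : m.degree (monomial b (1 : K) * u) = e := by
          rw [m.degree_mul (by simp) hu0, m.degree_monomial, if_neg one_ne_zero, hb']
        have hS := hW.sPolynomial_mem hu hw hb' ha
        -- The degrees agree, so the monomial multipliers in the S-polynomial are constants.
        rw [← hv, sPolynomial, hudeg, hvdeg, tsub_self, ← C_apply, ← C_apply, ← smul_eq_C_mul,
          ← smul_eq_C_mul] at hS
        have hlc : m.leadingCoeff v ≠ 0 := m.leadingCoeff_ne_zero_iff.mpr hv0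
        refine (Submodule.smul_mem_iff _ hlc).mp ?_
        rw [← sub_add_cancel (m.leadingCoeff v • (monomial b (1 : K) * u))
          (m.leadingCoeff (monomial b (1 : K) * u) • v)]
        exact add_mem (Submodule.mem_sup_right hS) (Submodule.mem_sup_left
          (Submodule.smul_mem _ _ (Submodule.mem_span_singleton_self v)))
    obtain ⟨_, hy, q, hq, rfl⟩ := Submodule.mem_sup.mp (hle hp)
    obtain ⟨c, rfl⟩ := Submodule.mem_span_singleton.mp hy
    have hqe : q.coeff e = 0 := by
      by_contra hne
      exact lt_irrefl _ (mem_of_mem_support_of_mem_shiftSpan (isLowerSet_Iio _) hq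
        (mem_support_iff.mpr hne))
    have hpe := m.coeff_eq_zero_of_lt hδ
    rw [coeff_add, hqe, add_zero, coeff_smul, smul_eq_mul, mul_eq_zero] at hpe
    rcases hpe with rfl | hve
    · simpa using hq
    · rw [← hvdeg, coeff_degree_eq_zero_iff] at hve
      exact absurd hve hv0
  · refine Submodule.span_mono ?_ hp
    rintro _ ⟨b, u, hu, hu0, hb, rfl⟩
    refine ⟨b, u, hu, hu0, (Set.mem_Iic.mp hb).lt_of_ne fun heq => ?_, rfl⟩
    exact hex ⟨b, u, hu, hu0, m.toSyn.injective heq⟩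

/-- Buchberger's criterion: if the S-polynomials of `W` have standard representations, so does every
element of the ideal generated by `W`. -/
theorem SPolynomialsReduce.mem_shiftSpan_degree (hW : m.SPolynomialsReduce W)
    {p : MvPolynomial σ K} (hp : p ∈ m.shiftSpan W D) :
    p ∈ m.shiftSpan W (Set.Iic (m.toSyn (m.degree p))) := by
  rcases exists_mem_shiftSpan_Iic hp with rfl | ⟨δ, -, hδ⟩
  · exact zero_mem _
  induction δ using WellFoundedLT.induction with
  | _ δ ih =>
    rcases lt_or_ge (m.toSyn (m.degree p)) δ with hlt | hge
    · rcases exists_mem_shiftSpan_Iic (hW.mem_shiftSpan_Iio hδ hlt) with rfl | ⟨ε, hε, hpε⟩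
      · exact zero_mem _
      · exact ih ε hε hpε
    · exact shiftSpan_mono (Set.Iic_subset_Iic.mpr hge) hδ

lemma mem_shiftSpan_univ_of_mem_span {ι : Type*} [Fintype ι] {f : ι → MvPolynomial σ K}
    (hf : ∀ i, f i ∈ W) {g : MvPolynomial σ K} (hg : g ∈ Ideal.span (Set.range f)) :
    g ∈ m.shiftSpan W Set.univ := by
  obtain ⟨h, rfl⟩ := Ideal.mem_span_range_iff_exists_fun.mp hg
  refine sum_mem fun i _ => ?_
  rcases eq_or_ne (f i) 0 with h0 | h0
  · simp [h0]
  · exact shiftSpan_mono (Set.subset_univ _) (mul_mem_shiftSpan (hf i) h0 le_rfl)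

end MonomialOrder

/-! ### Combinations with coefficients of bounded degree -/

namespace MvPolynomial

open scoped MonomialOrder

variable {σ K ι : Type*} [Field K] [Fintype ι] (f : ι → MvPolynomial σ K)

/-- The combinations `∑ hᵢ fᵢ` with coefficients `hᵢ` of total degree at most `C`. -/
noncomputable def boundedCombinations (C : ℕ) : Submodule K (MvPolynomial σ K) where
  carrier := {p | ∃ h : ι → MvPolynomial σ K, p = ∑ i, h i * f i ∧ ∀ i, (h i).totalDegree ≤ C}
  zero_mem' := ⟨0, by simp, by simp⟩
  add_mem' := by
    rintro _ _ ⟨h, rfl, hh⟩ ⟨k, rfl, hk⟩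
    exact ⟨h + k, by simp [add_mul, Finset.sum_add_distrib],
      fun i => (totalDegree_add _ _).trans (max_le (hh i) (hk i))⟩
  smul_mem' := by
    rintro c _ ⟨h, rfl, hh⟩
    exact ⟨c • h, by simp [Finset.smul_sum], fun i => (totalDegree_smul_le _ _).trans (hh i)⟩

variable {f}

lemma boundedCombinations_mono {C C' : ℕ} (h : C ≤ C') :
    boundedCombinations f C ≤ boundedCombinations f C' :=
  fun _ ⟨k, hp, hk⟩ => ⟨k, hp, fun i => (hk i).trans h⟩

lemma mul_mem_boundedCombinations {C C' : ℕ} {p q : MvPolynomial σ K}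
    (hp : p ∈ boundedCombinations f C) (hq : q.totalDegree + C ≤ C') :
    q * p ∈ boundedCombinations f C' := by
  obtain ⟨h, rfl, hh⟩ := hp
  refine ⟨fun i => q * h i, by simp [Finset.mul_sum, mul_assoc], fun i => ?_⟩
  exact (totalDegree_mul _ _).trans ((Nat.add_le_add_left (hh i) _).trans hq)

lemma mem_boundedCombinations (i : ι) (C : ℕ) : f i ∈ boundedCombinations f C := by
  classical
  exact ⟨Pi.single i 1, by simp [Pi.single_apply],
    fun j => by by_cases h : j = i <;> simp [h]⟩

lemma totalDegree_le_of_mem_boundedCombinations {C d : ℕ} (hf : ∀ i, (f i).totalDegree ≤ d)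
    {p : MvPolynomial σ K} (hp : p ∈ boundedCombinations f C) : p.totalDegree ≤ C + d := by
  obtain ⟨h, rfl, hh⟩ := hp
  exact totalDegree_finsetSum_le fun i _ =>
    (totalDegree_mul _ _).trans (Nat.add_le_add (hh i) (hf i))

section

variable [LinearOrder σ] [WellFoundedGT σ]

open MonomialOrder

lemma sPolynomial_mem_boundedCombinations {C D : ℕ} {w w' : MvPolynomial σ K}
    (hw : w ∈ boundedCombinations f C) (hw' : w' ∈ boundedCombinations f C)
    (hD : w.totalDegree ≤ D) (hD' : w'.totalDegree ≤ D) :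
    degLex.sPolynomial w w' ∈ boundedCombinations f (D + C) := by
  have aux : ∀ (u v : MvPolynomial σ K) (c : K), u.totalDegree ≤ D →
      -- Each multiplier in the S-polynomial divides the leading monomial of the other polynomial.
      (monomial (degLex.degree u - degLex.degree v) c).totalDegree ≤ D := by
    intro u v c hu
    refine (totalDegree_monomial_le _ _).trans (le_trans ?_ hu)
    rw [← degree_degLexDegree]
    exact Finsupp.degree_mono tsub_le_self
  exact sub_mem
    (mul_mem_boundedCombinations hw (Nat.add_le_add_right (aux _ _ _ hD') C))
    (mul_mem_boundedCombinations hw' (Nat.add_le_add_right (aux _ _ _ hD) C))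

lemma totalDegree_sPolynomial_le {D : ℕ} {w w' : MvPolynomial σ K}
    (hD : w.totalDegree ≤ D) (hD' : w'.totalDegree ≤ D) :
    (degLex.sPolynomial w w').totalDegree ≤ 2 * D := by
  -- The S-polynomial is a combination of the pair `w, w'` itself, with coefficients of degree at
  -- most `D`.
  refine (totalDegree_le_of_mem_boundedCombinations (f := ![w, w']) (d := D) (C := D) ?_ ?_).trans
    (by omega)
  · simp [Fin.forall_fin_two, hD, hD']
  · exact sPolynomial_mem_boundedCombinations (C := 0)
      (mem_boundedCombinations (f := ![w, w']) 0 0) (mem_boundedCombinations (f := ![w, w']) 1 0)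
      hD hD'

/-- If passing from coefficient degree `C` to `C + 2 * D` yields no new leading monomials, then the
combinations of coefficient degree `C` satisfy Buchberger's criterion. -/
lemma sPolynomialsReduce_boundedCombinations {C D : ℕ}
    (hD : ∀ w ∈ boundedCombinations f C, w.totalDegree ≤ D)
    (hstab : ∀ r ∈ boundedCombinations f (C + 2 * D), r ≠ 0 →
      ∃ w ∈ boundedCombinations f C, w ≠ 0 ∧ degLex.degree w ≤ degLex.degree r) :
    degLex.SPolynomialsReduce (boundedCombinations f C : Set (MvPolynomial σ K)) := by
  intro w hw w' hw' _
  set S := degLex.sPolynomial w w' with hS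
  have hSmem : S ∈ boundedCombinations f (C + 2 * D) := boundedCombinations_mono (by omega)
    (sPolynomial_mem_boundedCombinations hw hw' (hD w hw) (hD w' hw'))
  have hSdeg : S.totalDegree ≤ 2 * D := totalDegree_sPolynomial_le (hD w hw) (hD w' hw')
  obtain ⟨q, r, hq, hqdeg, hr⟩ := degLex.div_set
    (B := (boundedCombinations f C : Set (MvPolynomial σ K)) \ {0})
    (fun b hb => isUnit_leadingCoeff.mpr hb.2) S
  rw [Finsupp.linearCombination_apply, Finsupp.sum] at hq
  have hsum : ∀ b ∈ q.support, (q b • (b : MvPolynomial σ K)) ∈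
      boundedCombinations f (C + 2 * D) := by
    intro b _
    refine mul_mem_boundedCombinations b.2.1 ?_
    rcases eq_or_ne (q b) 0 with h0 | h0
    · simp [h0]
    have h1 := (degLex_totalDegree_monotone (hqdeg b)).trans hSdeg
    rw [totalDegree_mul_of_isDomain b.2.2 h0] at h1
    omega
  -- A nonzero remainder would have a leading monomial divisible by none from `V_C`, against
  -- `hstab`.
  have hr0 : r = 0 := by
    by_contra hr0
    obtain ⟨b, hb, hb0, hle⟩ := hstab r (by
      rw [eq_sub_of_add_eq' hq.symm]
      exact sub_mem hSmem (sum_mem hsum)) hr0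
    exact hr _ (degLex.degree_mem_support hr0) b ⟨hb, hb0⟩ hle
  rw [hr0, add_zero] at hq
  rw [hq, ← hq]
  nth_rewrite 2 [hq]
  exact sum_mem fun b _ => mul_mem_shiftSpan b.2.1 b.2.2 (by rw [mul_comm]; exact hqdeg b)

lemma shiftSpan_boundedCombinations_le {C : ℕ} (e : σ →₀ ℕ) :
    degLex.shiftSpan (boundedCombinations f C : Set (MvPolynomial σ K))
      (Set.Iic (degLex.toSyn e)) ≤ boundedCombinations f (C + e.degree) := by
  refine Submodule.span_le.mpr ?_
  rintro _ ⟨a, w, hw, -, ha, rfl⟩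
  refine mul_mem_boundedCombinations hw ?_
  have h1 : (a + degLex.degree w).degree ≤ e.degree := Finsupp.DegLex.monotone_degree ha
  rw [map_add] at h1
  have h2 := totalDegree_monomial_le a (1 : K)
  have h3 : (a.sum fun _ => id) = a.degree := rfl
  omega

/-- Ideal membership with bounded coefficients, once the leading monomials stabilise. -/
theorem mem_boundedCombinations_of_mem_span {C D : ℕ}
    (hD : ∀ w ∈ boundedCombinations f C, w.totalDegree ≤ D)
    (hstab : ∀ r ∈ boundedCombinations f (C + 2 * D), r ≠ 0 →
      ∃ w ∈ boundedCombinations f C, w ≠ 0 ∧ degLex.degree w ≤ degLex.degree r)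
    {g : MvPolynomial σ K} (hg : g ∈ Ideal.span (Set.range f)) :
    g ∈ boundedCombinations f (C + g.totalDegree) := by
  have := shiftSpan_boundedCombinations_le _
    ((sPolynomialsReduce_boundedCombinations hD hstab).mem_shiftSpan_degree
      (mem_shiftSpan_univ_of_mem_span (fun i => mem_boundedCombinations i C) hg))
  rwa [degree_degLexDegree] at this

end

/-- The leading monomials stabilise after fewer than `B(m, 3ⁿd)` steps. -/
lemma exists_leadingMonomials_stable {m d : ℕ} {f : ι → MvPolynomial (Fin (m + 1)) K}
    (hf : ∀ i, (f i).totalDegree ≤ d) {w₀ : MvPolynomial (Fin (m + 1)) K}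
    (hw₀ : w₀ ∈ boundedCombinations f 0) (hne : w₀ ≠ 0) :
    ∃ n ≤ AntichainBound.bound (m + 1) (fun n => 3 ^ n * d) - 1,
      ∀ r ∈ boundedCombinations f ((3 ^ (n + 1) - 1) * d), r ≠ 0 →
        ∃ w ∈ boundedCombinations f ((3 ^ n - 1) * d), w ≠ 0 ∧
          MonomialOrder.degLex.degree w ≤ MonomialOrder.degLex.degree r := by
  set B := AntichainBound.bound (m + 1) (fun n => 3 ^ n * d) with hB
  by_contra! hcon
  have hex : ∀ n, ∃ r, n ≤ B → r ∈ boundedCombinations f ((3 ^ n - 1) * d) ∧ r ≠ 0 ∧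
      ∀ n' < n, ∀ w ∈ boundedCombinations f ((3 ^ n' - 1) * d), w ≠ 0 →
        ¬ MonomialOrder.degLex.degree w ≤ MonomialOrder.degLex.degree r := by
    intro n
    rcases n with _ | n
    · exact ⟨w₀, fun _ => ⟨by simpa using hw₀, hne, fun n' h => absurd h (Nat.not_lt_zero _)⟩⟩
    · by_cases hn : n ≤ B - 1
      · obtain ⟨r, hr, hr0, h⟩ := hcon n hn
        refine ⟨r, fun _ => ⟨hr, hr0, fun n' hn' w hw hw0 => h w ?_ hw0⟩⟩
        refine boundedCombinations_mono (Nat.mul_le_mul_right d (Nat.sub_le_sub_right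
          (Nat.pow_le_pow_right (by norm_num) (Nat.lt_succ_iff.mp hn')) 1)) hw
      · exact ⟨0, fun _ => by omega⟩
  choose r hr using hex
  -- Bad sequences are indexed from 1, the chain from 0. The terms `0, …, B` make `B + 1`, one too
  -- many.
  have hbad : AntichainBound.IsBadSeq (fun n => 3 ^ n * d) (B + 1)
      (fun n x => MonomialOrder.degLex.degree (r (n - 1)) x) := by
    refine ⟨fun i h1 h2 x => ?_, fun i j h1 h2 h3 hle => ?_⟩
    · have h4 := totalDegree_le_of_mem_boundedCombinations hf (hr (i - 1) (by omega)).1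
      rw [← degree_degLexDegree] at h4
      refine (Finsupp.le_degree x _).trans (h4.trans ?_)
      rw [← Nat.succ_mul, Nat.succ_eq_add_one, Nat.sub_add_cancel (Nat.one_le_pow _ 3 (by norm_num))]
      exact Nat.mul_le_mul_right d (Nat.pow_le_pow_right (by norm_num) (Nat.sub_le i 1))
    · have hi := hr (i - 1) (by omega)
      exact (hr (j - 1) (by omega)).2.2 (i - 1) (by omega) _ hi.1 hi.2.1 hle
  have := hbad.le_bound _ _ _ (fun a b hab => Nat.mul_le_mul_right d
    (Nat.pow_le_pow_right (by norm_num) hab))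
  omega

end MvPolynomial

theorem corollary4p5 {K : Type*} [Field K] (m d : ℕ) (hm : 1 ≤ m) (hd : 1 ≤ d) (s : ℕ)
    (g : MvPolynomial (Fin m) K) (f : Fin s → MvPolynomial (Fin m) K)
    (hf : ∀ i, (f i).totalDegree ≤ d) :
    g ∈ Ideal.span (Set.range f) ↔
      ∃ h : Fin s → MvPolynomial (Fin m) K,
        g = ∑ i, h i * f i ∧
          ∀ i, (h i).totalDegree ≤ AntichainBound.gammaBound m d g.totalDegree := by
  constructor
  · intro hg
    change g ∈ MvPolynomial.boundedCombinations f _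
    obtain ⟨m, rfl⟩ := Nat.exists_eq_add_of_le' hm
    -- The sequence of leading monomials needs a nonzero first term.
    by_cases h0 : ∀ i, f i = 0
    · obtain rfl : f = 0 := funext h0
      have : g = 0 := by
        obtain ⟨h, rfl⟩ := Ideal.mem_span_range_iff_exists_fun.mp hg
        simp
      rw [this]
      exact zero_mem _
    push Not at h0
    obtain ⟨i, hi⟩ := h0
    obtain ⟨n, hn, hstab⟩ := MvPolynomial.exists_leadingMonomials_stable hf
      (MvPolynomial.mem_boundedCombinations i 0) hi
    have h3 : 1 ≤ 3 ^ n := Nat.one_le_pow _ 3 (by norm_num)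
    have hD : ∀ w ∈ MvPolynomial.boundedCombinations f ((3 ^ n - 1) * d),
        w.totalDegree ≤ 3 ^ n * d := fun w hw => by
      have := MvPolynomial.totalDegree_le_of_mem_boundedCombinations hf hw
      rwa [← Nat.succ_mul, Nat.succ_eq_add_one, Nat.sub_add_cancel h3] at this
    -- The base 3 comes from here: `C` grows by twice the degree bound `D = 3ⁿ d`.
    have hC : (3 ^ (n + 1) - 1) * d = (3 ^ n - 1) * d + 2 * (3 ^ n * d) := by
      rw [← mul_assoc, ← add_mul]
      congr 1
      omega
    rw [hC] at hstab
    refine MvPolynomial.boundedCombinations_mono ?_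
      (MvPolynomial.mem_boundedCombinations_of_mem_span hD hstab hg)
    exact Nat.add_le_add_right (Nat.mul_le_mul_right d (Nat.sub_le_sub_right
      (Nat.pow_le_pow_right (by norm_num) hn) 1)) _
  · rintro ⟨h, hg, -⟩
    exact Ideal.mem_span_range_iff_exists_fun.mpr ⟨h, hg.symm⟩
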